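/- For a square complex matrix $A$ let $A^D$ be its Drazin inverse, i.e. the unique matrix with $AA^D=A^DA$, $A^D=A^DAA^D$ and $A^m=A^{m+1}A^D$ for some $m\in\mathbb N$, and let $A^\pi=I-AA^D$. For $E,F\in\mathbb C^{n\times n}$ put $U=EF^D$ and define matrices $A_i,B_i,C_i,D_i$ $(i\ge 1)$ by $$A_1=-F^DU,\quad B_1=(F^D)^2+F^DU^2,\quad C_1=F^D+FF^DU^2,\quad D_1=-F^DU-FF^DUF^D-FF^DU^3,$$ $$A_{i+1}=F^DA_i-F^DUC_i,\qquad B_{i+1}=F^DB_i-F^DUD_i,$$ $$C_{i+1}=-FF^DUA_i+(F^D+FF^DU^2)C_i,\qquad D_{i+1}=-FF^DUB_i+(F^D+FF^DU^2)D_i .$$ Put $$Z_i=E^\pi F^iF^\pi-\sum_{j=1}^\infty (E^D)^{2j}F^{j}F^{i}F^\pi\quad(i\ge 0),$$ $$S_i=Z_iE+E^\pi E^{2i}F^\pi EFF^D+\sum_{k=0}^{i-2}E^\pi E^{2k+2}F^{i-k-1}F^\pi E\quad(i\ge1),$$ $$T_i=E^\pi E^{2i-1}F^\pi EFF^D-\sum_{j=0}^\infty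 (E^D)^{2j+1}F^{i+j}F^\pi E+\sum_{k=0}^{i-2}E^\pi E^{2k+1}F^{i-k-1}F^\pi E\quad(i\ge1),$$ and $$\Gamma=\sum_{i=0}^\infty (E^D)^{2i+1}F^iF^\pi+Z_0EF^D+\sum_{i=1}^\infty S_iF^DC_i+\sum_{i=1}^\infty T_iA_i,$$ $$\Delta=F^D-E^DF^\pi EF^D-\sum_{i=1}^\infty (E^D)^{2i+1}F^iF^\pi EF^D+\sum_{i=0}^\infty (E^D)^{2i+2}F^iF^\pi-Z_0EF^DEF^D+\sum_{i=1}^\infty S_iF^DD_i+\sum_{i=1}^\infty T_iB_i,$$ $$\Lambda=FF^D+\sum_{i=1}^\infty F^iF^\pi EA_i,\qquad \Xi=-FF^DEF^D+\sum_{i=1}^\infty F^iF^\pi EB_i .\qquad(*)$$ All these series have only finitely many nonzero terms. **Claim.** Let $P,Q\in\mathbb C^{n\times n}$ with $Q^2=0$ and $PQP(PQ)^\pi=0$, and let $$K=\begin{pmatrix}P&PQ\\ I&0\end{pmatrix},\qquad L=\begin{pmatrix}0&0\\ 0&Q\end{pmatrix}.$$ Then $$(P+Q)^D=\begin{pmatrix}I&Q\end{pmatrix}\big[K^D+L(K^D)^2\big]^2\begin{pmatrix}P\\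 I\end{pmatrix},\qquad K^D=\begin{pmatrix}P&I\\ I&0\end{pmatrix}\begin{pmatrix}\Gamma&\Delta\\ \Lambda&\Xi\end{pmatrix}^2\begin{pmatrix}I&0\\ 0&PQ\end{pmatrix},$$ where $\Gamma,\Delta,\Lambda,\Xi$ are as in $(*)$ with $E=P$, $F=PQ$; moreover $$\begin{pmatrix}P&I\\ PQ&0\end{pmatrix}^D=\begin{pmatrix}\Gamma&\Delta\\ \Lambda&\Xi\end{pmatrix}.$$ -/

import Mathlib

/-- `X` satisfies the defining relations of the Drazin inverse of the square complex matrix `A`: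
`A X = X A`, `X = X A X` and `A ^ m = A ^ (m + 1) X` for some natural number `m`. -/
def IsDrazinInverse {ι : Type*} [Fintype ι] [DecidableEq ι] (A X : Matrix ι ι ℂ) : Prop :=
  A * X = X * A ∧ X = X * A * X ∧ ∃ m : ℕ, A ^ m = A ^ (m + 1) * X

/-- Every square complex matrix has a Drazin inverse. -/
theorem exists_isDrazinInverse {ι : Type*} [Fintype ι] [DecidableEq ι] (A : Matrix ι ι ℂ) :
    ∃ X : Matrix ι ι ℂ, IsDrazinInverse A X := by
  obtain ⟨m, s, hs⟩ : ∃ (m : ℕ) (s : Polynomial ℂ),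
      A ^ m = A ^ (m + 1) * Polynomial.aeval A s := by
    have hp : A.charpoly ≠ 0 := A.charpoly_monic.ne_zero
    obtain ⟨r, hr, hnd⟩ :=
      Polynomial.exists_eq_pow_rootMultiplicity_mul_and_not_dvd A.charpoly hp 0
    set m := Polynomial.rootMultiplicity 0 A.charpoly with hm
    rw [map_zero, sub_zero] at hr hnd
    have hc : r.coeff 0 ≠ 0 := fun h => hnd (Polynomial.X_dvd_iff.mpr h)
    have h0 : Polynomial.aeval A A.charpoly = 0 := Matrix.aeval_self_charpoly A
    refine ⟨m, Polynomial.C (-(r.coeff 0)⁻¹) * r.divX, ?_⟩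
    have hX : r = Polynomial.X * r.divX + Polynomial.C (r.coeff 0) :=
      (Polynomial.X_mul_divX_add r).symm
    have key : (Polynomial.X ^ m : Polynomial ℂ)
        = Polynomial.X ^ (m + 1) * (Polynomial.C (-(r.coeff 0)⁻¹) * r.divX)
          + Polynomial.C ((r.coeff 0)⁻¹) * A.charpoly := by
      have h1 : Polynomial.C ((r.coeff 0)⁻¹) * Polynomial.C (r.coeff 0) = (1 : Polynomial ℂ) := by
        rw [← Polynomial.C_mul, inv_mul_cancel₀ hc, Polynomial.C_1]
      have h2 : A.charpoly
          = Polynomial.X ^ m * (Polynomial.X * r.divX + Polynomial.C (r.coeff 0)) := by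
        rw [← hX]; exact hr
      rw [h2, Polynomial.C_neg]
      linear_combination (-(Polynomial.X ^ m : Polynomial ℂ)) * h1
    have := congrArg (Polynomial.aeval A) key
    simpa only [map_add, map_mul, map_pow, Polynomial.aeval_X, h0, mul_zero, add_zero] using this
  set g := Polynomial.aeval A s with hg
  have hcomm : Commute A g := by
    have : Commute (Polynomial.aeval A (Polynomial.X : Polynomial ℂ)) (Polynomial.aeval A s) := by
      simp only [Commute, SemiconjBy, ← map_mul, mul_comm]
    simpa using this
  have hk : ∀ k : ℕ, A ^ m = A ^ (m + k) * g ^ k := by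
    intro k
    induction k with
    | zero => simp
    | succ k ih =>
      calc A ^ m = A ^ k * A ^ m * g ^ k := by rw [← pow_add, add_comm k m]; exact ih
        _ = A ^ k * (A ^ (m + 1) * g) * g ^ k := by rw [← hs]
        _ = A ^ (m + (k + 1)) * g ^ (k + 1) := by
          rw [← mul_assoc, ← pow_add, mul_assoc, ← pow_succ']
          congr 2
          ring
  refine ⟨A ^ m * g ^ (m + 1), ?_, ?_, m, ?_⟩
  · exact ((Commute.refl A).pow_right m).mul_right (hcomm.pow_right (m + 1))
  · have e : A ^ m * g ^ (m + 1) * A = A ^ (m + 1) * g ^ (m + 1) := by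
      rw [mul_assoc, ← (hcomm.pow_right (m + 1)).eq, ← mul_assoc, ← pow_succ]
    rw [e, mul_assoc, ← mul_assoc (g ^ (m + 1)), ← ((hcomm.pow_pow m (m + 1)).eq), ← mul_assoc,
      ← mul_assoc, ← pow_add, show m + 1 + m = m + (m + 1) by ring, ← hk (m + 1)]
  · rw [← mul_assoc, ← pow_add, show m + 1 + m = m + (m + 1) by ring, ← hk (m + 1)]

/-- The Drazin inverse of a square complex matrix is unique. -/
theorem IsDrazinInverse.unique {ι : Type*} [Fintype ι] [DecidableEq ι] {A X Y : Matrix ι ι ℂ}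
    (hX : IsDrazinInverse A X) (hY : IsDrazinInverse A Y) : X = Y := by
  have aux : ∀ Z : Matrix ι ι ℂ, A * Z = Z * A → Z = Z * A * Z →
      ∀ k : ℕ, Z = A ^ k * Z ^ (k + 1) := by
    intro Z hc hz k
    induction k with
    | zero => simp
    | succ k ih =>
      have hc' : Commute A Z := hc
      have hz' : Z = A * Z ^ 2 := by rw [sq, ← mul_assoc, hc]; exact hz
      calc Z = A ^ k * Z ^ (k + 1) := ih
        _ = A ^ k * (Z * Z ^ k) := by rw [pow_succ']
        _ = A ^ k * ((A * Z ^ 2) * Z ^ k) := by rw [← hz']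
        _ = A ^ (k + 1) * Z ^ (k + 1 + 1) := by
          rw [mul_assoc A, ← pow_add, ← mul_assoc, ← pow_succ]
          congr 2
          ring
  have step : ∀ Z W : Matrix ι ι ℂ, IsDrazinInverse A Z → IsDrazinInverse A W →
      W * A * Z = Z := by
    rintro Z W ⟨hc, hz, -⟩ ⟨hc', -, m, hm⟩
    have hm' : W * A * A ^ m = A ^ m := by
      have h : Commute A W := hc'
      rw [mul_assoc, ← pow_succ', ← (h.pow_left (m + 1)).eq]
      exact hm.symm
    rw [aux Z hc hz m, ← mul_assoc, hm']
  have step' : ∀ Z W : Matrix ι ι ℂ, IsDrazinInverse A Z → IsDrazinInverse A W →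
      Z * A * W = Z := by
    rintro Z W ⟨hc, hz, -⟩ ⟨-, -, m, hm⟩
    have hZ : Z = Z ^ (m + 1) * A ^ m := by
      have h : Commute A Z := hc
      rw [← (h.pow_pow m (m + 1)).eq]
      exact aux Z hc hz m
    calc Z * A * W = Z ^ (m + 1) * (A ^ (m + 1) * W) := by
          conv_lhs => rw [hZ]
          rw [mul_assoc _ (A ^ m) A, ← pow_succ, mul_assoc]
      _ = Z := by rw [← hm, ← hZ]
  exact (step' X Y hX hY).symm.trans (step Y X hY hX)

/-- The Drazin inverse `A ^ D` of a square complex matrix. -/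
noncomputable def drazin {ι : Type*} [Fintype ι] [DecidableEq ι] (A : Matrix ι ι ℂ) :
    Matrix ι ι ℂ :=
  Classical.choose (exists_isDrazinInverse A)

theorem isDrazinInverse_drazin {ι : Type*} [Fintype ι] [DecidableEq ι] (A : Matrix ι ι ℂ) :
    IsDrazinInverse A (drazin A) :=
  Classical.choose_spec (exists_isDrazinInverse A)

/-- The eigenprojection `A ^ π = I - A A ^ D` of `A` at the eigenvalue `0`. -/
noncomputable def eigenproj {ι : Type*} [Fintype ι] [DecidableEq ι] (A : Matrix ι ι ℂ) :
    Matrix ι ι ℂ :=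
  1 - A * drazin A

namespace Star

/-! The blocks of the Drazin inverse of the block matrix with rows `(E, I)` and `(F, 0)`. All series
below have only finitely many nonzero terms (see `eventually_zero`), so `∑'` is a finite sum. -/

/-- The four matrices `(A_(i+1), B_(i+1), C_(i+1), D_(i+1))`, by recursion on `i`: they are the
blocks of the power `2 (i + 1) + 1` of the matrix with rows `(0, F^D)` and
`(F F^D, -F F^D E F^D)`. -/
noncomputable def coeff {ι : Type*} [Fintype ι] [DecidableEq ι] (E F : Matrix ι ι ℂ) :
    ℕ → Matrix ι ι ℂ × Matrix ι ι ℂ × Matrix ι ι ℂ × Matrix ι ι ℂ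
  | 0 =>
    (-(drazin F * (E * drazin F)),
      drazin F ^ 2 + drazin F * (E * drazin F) ^ 2,
      drazin F + F * drazin F * (E * drazin F) ^ 2,
      -(drazin F * (E * drazin F)) - F * drazin F * (E * drazin F) * drazin F
        - F * drazin F * (E * drazin F) ^ 3)
  | i + 1 =>
    let A := (coeff E F i).1
    let B := (coeff E F i).2.1
    let C := (coeff E F i).2.2.1
    let D := (coeff E F i).2.2.2
    (drazin F * A - drazin F * (E * drazin F) * C,
      drazin F * B - drazin F * (E * drazin F) * D,
      -(F * drazin F * (E * drazin F) * A)
        + (drazin F + F * drazin F * (E * drazin F) ^ 2) * C,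
      -(F * drazin F * (E * drazin F) * B)
        + (drazin F + F * drazin F * (E * drazin F) ^ 2) * D)

/-- `A_(i+1)`. -/
noncomputable def coeffA {ι : Type*} [Fintype ι] [DecidableEq ι] (E F : Matrix ι ι ℂ) (i : ℕ) :
    Matrix ι ι ℂ := (coeff E F i).1

/-- `B_(i+1)`. -/
noncomputable def coeffB {ι : Type*} [Fintype ι] [DecidableEq ι] (E F : Matrix ι ι ℂ) (i : ℕ) :
    Matrix ι ι ℂ := (coeff E F i).2.1

/-- `C_(i+1)`. -/
noncomputable def coeffC {ι : Type*} [Fintype ι] [DecidableEq ι] (E F : Matrix ι ι ℂ) (i : ℕ) :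
    Matrix ι ι ℂ := (coeff E F i).2.2.1

/-- `D_(i+1)`. -/
noncomputable def coeffD {ι : Type*} [Fintype ι] [DecidableEq ι] (E F : Matrix ι ι ℂ) (i : ℕ) :
    Matrix ι ι ℂ := (coeff E F i).2.2.2

/-- `(E^π - ∑_{j ≥ 1} (E^D)^(2j) F^j) F^i F^π`, with the right factor `F^i F^π` distributed into the
sum, which makes it finite. -/
noncomputable def head {ι : Type*} [Fintype ι] [DecidableEq ι] (E F : Matrix ι ι ℂ) (i : ℕ) :
    Matrix ι ι ℂ :=
  eigenproj E * F ^ i * eigenproj F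
    - ∑' j : ℕ, drazin E ^ (2 * (j + 1)) * F ^ (j + 1) * F ^ i * eigenproj F

/-- For `i ≥ 1`, the bracket in front of `F^D C_i` and `F^D D_i`. -/
noncomputable def evenBracket {ι : Type*} [Fintype ι] [DecidableEq ι] (E F : Matrix ι ι ℂ)
    (i : ℕ) : Matrix ι ι ℂ :=
  head E F i * E + eigenproj E * E ^ (2 * i) * eigenproj F * E * F * drazin F
    + ∑ k ∈ Finset.range (i - 1),
        eigenproj E * E ^ (2 * k + 2) * F ^ (i - k - 1) * eigenproj F * E

/-- For `i ≥ 1`, the bracket in front of `A_i` and `B_i`. -/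
noncomputable def oddBracket {ι : Type*} [Fintype ι] [DecidableEq ι] (E F : Matrix ι ι ℂ)
    (i : ℕ) : Matrix ι ι ℂ :=
  eigenproj E * E ^ (2 * i - 1) * eigenproj F * E * F * drazin F
    - ∑' j : ℕ, drazin E ^ (2 * j + 1) * F ^ (i + j) * eigenproj F * E
    + ∑ k ∈ Finset.range (i - 1),
        eigenproj E * E ^ (2 * k + 1) * F ^ (i - k - 1) * eigenproj F * E

/-- Every term of every series in this section contains `F^i F^π` for an index `i` that grows with
the summation index, or one of the two brackets as a factor, so all but finitely many terms vanish. -/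
theorem eventually_zero {ι : Type*} [Fintype ι] [DecidableEq ι] (E F : Matrix ι ι ℂ) :
    ∃ N : ℕ, ∀ i ≥ N, F ^ i * eigenproj F = 0 ∧
      evenBracket E F i = 0 ∧ oddBracket E F i = 0 := by
  have base : ∀ A : Matrix ι ι ℂ, ∃ N : ℕ, ∀ i ≥ N,
      A ^ i * eigenproj A = 0 ∧ eigenproj A * A ^ i = 0 := by
    intro A
    obtain ⟨hc, -, m, hm⟩ := isDrazinInverse_drazin A
    have hm0 : A ^ m * eigenproj A = 0 := by
      rw [eigenproj, mul_sub, mul_one, ← mul_assoc, ← pow_succ, ← hm, sub_self]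
    have hcomm : Commute A (eigenproj A) := by
      have h : Commute A (drazin A) := hc
      exact (Commute.one_right A).sub_right ((Commute.refl A).mul_right h)
    refine ⟨m, fun i hi => ?_⟩
    have h0 : A ^ i * eigenproj A = 0 := by
      rw [← Nat.sub_add_cancel hi, pow_add, mul_assoc, hm0, mul_zero]
    exact ⟨h0, by rw [← (hcomm.pow_left i).eq, h0]⟩
  obtain ⟨N, hN⟩ := base F
  obtain ⟨K, hK⟩ := base E
  refine ⟨2 * N + 2 * K + 2, fun i hi => ?_⟩
  have hF : ∀ l ≥ N, F ^ l * eigenproj F = 0 := fun l hl => (hN l hl).1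
  have hE : ∀ l ≥ K, eigenproj E * E ^ l = 0 := fun l hl => (hK l hl).2
  have hsum : ∀ c, ∑ k ∈ Finset.range (i - 1),
      eigenproj E * E ^ (2 * k + c) * F ^ (i - k - 1) * eigenproj F * E = 0 := by
    intro c
    refine Finset.sum_eq_zero fun k _ => ?_
    rcases le_total K k with h | h
    · rw [hE _ (by omega)]; simp
    · rw [mul_assoc (eigenproj E * _), hF _ (by omega)]; simp
  refine ⟨hF _ (by omega), ?_, ?_⟩
  · have h1 : head E F i = 0 := by
      simp only [head, tsum_zero, sub_zero, mul_assoc, hF i (by omega), mul_zero]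
    rw [evenBracket, h1, hE _ (by omega), hsum]
    simp
  · have h2 : ∀ j : ℕ, drazin E ^ (2 * j + 1) * F ^ (i + j) * eigenproj F * E = 0 := fun j => by
      rw [mul_assoc (drazin E ^ _), hF _ (by omega)]; simp
    rw [oddBracket, hE _ (by omega), hsum]
    simp [h2]

/-- The block `Γ`. -/
noncomputable def Gam {ι : Type*} [Fintype ι] [DecidableEq ι] (E F : Matrix ι ι ℂ) :
    Matrix ι ι ℂ :=
  ∑' i : ℕ, drazin E ^ (2 * i + 1) * F ^ i * eigenproj F
    + head E F 0 * E * drazin F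
    + ∑' i : ℕ, evenBracket E F (i + 1) * drazin F * coeffC E F i
    + ∑' i : ℕ, oddBracket E F (i + 1) * coeffA E F i

/-- The block `Δ`. -/
noncomputable def Del {ι : Type*} [Fintype ι] [DecidableEq ι] (E F : Matrix ι ι ℂ) :
    Matrix ι ι ℂ :=
  drazin F - drazin E * eigenproj F * E * drazin F
    - ∑' i : ℕ, drazin E ^ (2 * (i + 1) + 1) * F ^ (i + 1) * eigenproj F * E * drazin F
    + ∑' i : ℕ, drazin E ^ (2 * i + 2) * F ^ i * eigenproj F
    - head E F 0 * E * drazin F * E * drazin F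
    + ∑' i : ℕ, evenBracket E F (i + 1) * drazin F * coeffD E F i
    + ∑' i : ℕ, oddBracket E F (i + 1) * coeffB E F i

/-- The block `Λ`. -/
noncomputable def Lam {ι : Type*} [Fintype ι] [DecidableEq ι] (E F : Matrix ι ι ℂ) :
    Matrix ι ι ℂ :=
  F * drazin F + ∑' i : ℕ, F ^ (i + 1) * eigenproj F * E * coeffA E F i

/-- The block `Ξ`. -/
noncomputable def Xi {ι : Type*} [Fintype ι] [DecidableEq ι] (E F : Matrix ι ι ℂ) :
    Matrix ι ι ℂ :=
  -(F * drazin F * E * drazin F) + ∑' i : ℕ, F ^ (i + 1) * eigenproj F * E * coeffB E F i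

end Star

/-! ### Drazin inverses of products, sums and block matrices. -/

section DrazinLemmas

variable {ι κ : Type*} [Fintype ι] [DecidableEq ι] [Fintype κ] [DecidableEq κ]

/-! The hypotheses are much stronger than they look. Since `(PQ)^D = ((PQ)^D)² P Q` and `Q² = 0`,
one has `(PQ)^D Q = 0`, so `(PQ)^π` fixes `Q` and `(PQ)² = P Q P (PQ)^π Q = 0`. Hence `(PQ)^D = 0`,
`(PQ)^π = I`, and the second hypothesis says `P Q P = 0`. All coefficients `A_i, B_i, C_i, D_i`
vanish and the four blocks become explicit polynomials in `P^D` and `PQ`.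

The Drazin inverse of the matrix with rows `(P, I)` and `(PQ, 0)` is then checked directly
(`IsDrazinInverse.fromBlocks_of_mul_eq_zero`). The other two formulas come from Cline's formula
`(AB)^D = A ((BA)^D)² B`: reversing a factorization turns that matrix into `K`, and `K + L` into `P
+ Q`. As `K L = 0` and `L² = 0`, `IsDrazinInverse.add_of_mul_eq_zero` handles `K + L`. -/

theorem IsDrazinInverse.drazin_eq {A X : Matrix ι ι ℂ} (h : IsDrazinInverse A X) :
    drazin A = X :=
  (isDrazinInverse_drazin A).unique h

theorem IsDrazinInverse.mul_sq {A X : Matrix ι ι ℂ} (h : IsDrazinInverse A X) :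
    A * X ^ 2 = X := by
  rw [sq, ← mul_assoc, h.1, ← h.2.1]

theorem IsDrazinInverse.sq_mul {A X : Matrix ι ι ℂ} (h : IsDrazinInverse A X) :
    X ^ 2 * A = X := by
  rw [sq, mul_assoc, ← h.1, ← mul_assoc, ← h.2.1]

theorem drazin_eq_zero_of_sq_eq_zero {A : Matrix ι ι ℂ} (h : A ^ 2 = 0) : drazin A = 0 :=
  IsDrazinInverse.drazin_eq ⟨by simp, by simp, 2, by simp [h]⟩

theorem Matrix.mul_pow_mul_comm (A : Matrix ι κ ℂ) (B : Matrix κ ι ℂ) (m : ℕ) :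
    (A * B) ^ m * A = A * (B * A) ^ m := by
  induction m with
  | zero => simp
  | succ m ih => rw [pow_succ', Matrix.mul_assoc, ih, pow_succ']; simp only [Matrix.mul_assoc]

/-- Cline's formula. -/
theorem IsDrazinInverse.cline {A : Matrix ι κ ℂ} {B : Matrix κ ι ℂ} {Y : Matrix κ κ ℂ}
    (h : IsDrazinInverse (B * A) Y) : IsDrazinInverse (A * B) (A * Y ^ 2 * B) := by
  have h1 : A * B * (A * Y ^ 2 * B) = A * Y * B := by
    conv_rhs => rw [← h.mul_sq]
    simp only [Matrix.mul_assoc]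
  have h2 : A * Y ^ 2 * B * (A * B) = A * Y * B := by
    conv_rhs => rw [← h.sq_mul]
    simp only [Matrix.mul_assoc]
  refine ⟨h1.trans h2.symm, ?_, ?_⟩
  · rw [h2]
    calc A * Y ^ 2 * B = A * (Y * (B * A * Y ^ 2)) * B := by rw [h.mul_sq, ← sq]
      _ = A * Y * B * (A * Y ^ 2 * B) := by simp only [Matrix.mul_assoc]
  · obtain ⟨m, hm⟩ := h.2.2
    -- One more than the exponent for `B A`, because `(AB)^(m+1) = A (BA)^m B`.
    refine ⟨m + 1, ?_⟩
    have e : A * (B * A) ^ (m + 1) * Y * B = A * (B * A) ^ m * B := by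
      rw [Matrix.mul_assoc A, ← hm]
    rw [pow_succ (A * B) (m + 1), Matrix.mul_assoc, h1, ← Matrix.mul_assoc, ← Matrix.mul_assoc,
      Matrix.mul_pow_mul_comm, e, pow_succ, ← Matrix.mul_assoc, Matrix.mul_pow_mul_comm]

/-- The Drazin inverse of a sum `A + B` with `A * B = 0` and `B ^ 2 = 0`. -/
theorem IsDrazinInverse.add_of_mul_eq_zero {A B X : Matrix ι ι ℂ} (h : IsDrazinInverse A X)
    (hAB : A * B = 0) (hB : B ^ 2 = 0) : IsDrazinInverse (A + B) (X + B * X ^ 2) := by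
  have hXB : X * B = 0 := by rw [← h.sq_mul, mul_assoc, hAB, mul_zero]
  have hBB : B * B = 0 := by rw [← sq, hB]
  have h1 : (A + B) * (X + B * X ^ 2) = A * X + B * X := by
    rw [add_mul, mul_add, mul_add, ← mul_assoc A B, hAB, ← mul_assoc B B, hBB]
    simp
  have h2 : (X + B * X ^ 2) * (A + B) = A * X + B * X := by
    rw [add_mul, mul_add, mul_add, hXB, mul_assoc B _ A, h.sq_mul, mul_assoc B _ B, sq X,
      mul_assoc X X B, hXB, h.1]
    simp
  refine ⟨h1.trans h2.symm, ?_, ?_⟩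
  · have e : A * X * B = 0 := by rw [mul_assoc, hXB, mul_zero]
    have e' : B * X * B = 0 := by rw [mul_assoc, hXB, mul_zero]
    rw [h2, mul_add, add_mul, add_mul, ← mul_assoc _ B, ← mul_assoc _ B, e, e', h.1, ← h.2.1,
      mul_assoc B X X, ← sq]
    simp
  · obtain ⟨m, hm⟩ := h.2.2
    -- Every word containing `A B` or `B B` vanishes, so `B` can only stand in first place.
    have hpow : ∀ k : ℕ, (A + B) ^ (k + 1) = A ^ (k + 1) + B * A ^ k := by
      intro k
      induction k with
      | zero => simp
      | succ k ih =>
        rw [pow_succ', ih, add_mul, mul_add, mul_add, ← mul_assoc A B, hAB, ← mul_assoc B B, hBB,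
          ← pow_succ']
        simp
    have hz : ∀ k : ℕ, A ^ (k + 1) * B = 0 := fun k => by rw [pow_succ, mul_assoc, hAB, mul_zero]
    have hX : ∀ k : ℕ, A ^ (m + k) = A ^ (m + k + 1) * X := fun k => by
      rw [show m + k + 1 = k + (m + 1) by ring, pow_add A k, mul_assoc, ← hm, ← pow_add, add_comm]
    have hm' : A ^ (m + 1) = A ^ (m + 1 + 1) * X := hX 1
    have hm'' : A ^ (m + 1 + 1) = A ^ (m + 1 + 1 + 1) * X := hX 2
    -- The second extra power leaves at least one `A` before the `B` in `B A^(m+1) B X`, so `hz`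
    -- kills this term even for `m = 0`.
    refine ⟨m + 1 + 1, ?_⟩
    rw [pow_succ (A + B) (m + 1 + 1), mul_assoc, h1, hpow, add_mul, mul_add, mul_add,
      ← mul_assoc _ B, hz, mul_assoc B _ (B * X), ← mul_assoc _ B X, hz, ← mul_assoc,
      ← pow_succ, ← hm'', mul_assoc B _ (A * X), ← mul_assoc (A ^ (m + 1)), ← pow_succ, ← hm']
    simp

/-- The Drazin inverse of the block matrix with rows `(E, 1)` and `(F, 0)` when `F * E = 0` and
`F ^ 2 = 0`. -/
theorem IsDrazinInverse.fromBlocks_of_mul_eq_zero {E F X : Matrix ι ι ℂ}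
    (h : IsDrazinInverse E X) (hFE : F * E = 0) (hF : F * F = 0) :
    IsDrazinInverse (Matrix.fromBlocks E 1 F 0)
      (Matrix.fromBlocks (X + X ^ 3 * F) (X ^ 2 + X ^ 4 * F) 0 0) := by
  have hFX : F * X = 0 := by rw [← h.mul_sq, ← mul_assoc, hFE, zero_mul]
  have hFXp : ∀ k : ℕ, F * X ^ (k + 1) = 0 := fun k => by
    rw [pow_succ', ← mul_assoc, hFX, zero_mul]
  have hEXp : ∀ k : ℕ, E * X ^ (k + 2) = X ^ (k + 1) := fun k => by
    rw [add_comm, pow_add, ← mul_assoc, h.mul_sq, pow_succ']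
  have h1 : Matrix.fromBlocks E 1 F 0 *
      Matrix.fromBlocks (X + X ^ 3 * F) (X ^ 2 + X ^ 4 * F) 0 0
      = Matrix.fromBlocks (E * X + X ^ 2 * F) (X + X ^ 3 * F) 0 0 := by
    simp [Matrix.fromBlocks_multiply, mul_add, ← mul_assoc, hFX, hFXp, hEXp]
  have h2 : (Matrix.fromBlocks (X + X ^ 3 * F) (X ^ 2 + X ^ 4 * F) 0 0 : Matrix (ι ⊕ ι) (ι ⊕ ι) ℂ) *
      Matrix.fromBlocks E 1 F 0
      = Matrix.fromBlocks (E * X + X ^ 2 * F) (X + X ^ 3 * F) 0 0 := by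
    simp [Matrix.fromBlocks_multiply, add_mul, mul_assoc, hFE, hF, h.1]
  refine ⟨h1.trans h2.symm, ?_, ?_⟩
  · have e : E * X * X = X := by rw [mul_assoc, ← sq, h.mul_sq]
    have e' : ∀ k : ℕ, E * X * X ^ (k + 1) = X ^ (k + 1) := fun k => by
      rw [pow_succ', ← mul_assoc, e]
    rw [h2, Matrix.fromBlocks_multiply]
    simp only [mul_add, add_mul, ← mul_assoc, e, e' 1, e' 2, e' 3, mul_assoc _ F, hFX, hFXp 1,
      hFXp 2, hFXp 3, mul_zero, zero_mul, add_zero]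
  · obtain ⟨m, hm⟩ := h.2.2
    have hFEp : ∀ k : ℕ, F * E ^ (k + 1) = 0 := fun k => by
      rw [pow_succ', ← mul_assoc, hFE, zero_mul]
    -- The lower rows of the successive powers are `(F, 0)`, `(0, F)`, `(0, 0)`, so the pattern is
    -- uniform from exponent 3 on.
    have hpow : ∀ k : ℕ, (Matrix.fromBlocks E 1 F 0 : Matrix (ι ⊕ ι) (ι ⊕ ι) ℂ) ^ (k + 3)
        = Matrix.fromBlocks (E ^ (k + 3) + E ^ (k + 1) * F) (E ^ (k + 2) + E ^ k * F) 0 0 := by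
      intro k
      induction k with
      | zero =>
        simp [pow_succ, Matrix.fromBlocks_multiply, hFE, hF, add_mul, mul_assoc]
      | succ k ih =>
        rw [pow_succ', ih, Matrix.fromBlocks_multiply]
        have hk : F * (E ^ k * F) = 0 := by
          rcases k with _ | k
          · simpa using hF
          · rw [← mul_assoc, hFEp, zero_mul]
        simp only [mul_add, ← mul_assoc, hFEp, ← pow_succ']
        simp [mul_assoc, hk, add_right_comm]
    have hk : ∀ k : ℕ, E ^ (m + k + 1) * X = E ^ (m + k) := fun k => by
      rw [show m + k + 1 = k + (m + 1) by ring, pow_add, mul_assoc, ← hm, ← pow_add, add_comm]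
    have hk2 : ∀ k : ℕ, E ^ (m + k + 2) * X ^ 2 = E ^ (m + k) := fun k => by
      rw [sq, ← mul_assoc, show E ^ (m + k + 2) * X = E ^ (m + k + 1) from hk (k + 1), hk]
    have hk3 : ∀ k : ℕ, E ^ (m + k + 3) * X ^ 3 = E ^ (m + k) := fun k => by
      rw [pow_succ' X, ← mul_assoc, show E ^ (m + k + 3) * X = E ^ (m + k + 2) from hk (k + 2), hk2]
    refine ⟨m + 3, ?_⟩
    rw [pow_succ _ (m + 3), mul_assoc, h1, hpow, Matrix.fromBlocks_multiply]
    have a1 := hk2 1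
    have a2 := hk 2
    have a3 := hk3 0
    simp only [add_zero] at a3
    have a4 : E ^ (m + 3) * E * X = E ^ (m + 3) := by rw [← pow_succ]; exact hk 3
    simp only [mul_add, add_mul, ← mul_assoc, a1, a2, a3, a4, mul_assoc _ F, hFE, hFX, hFXp 1,
      hFXp 2, mul_zero, zero_mul, add_zero]

end DrazinLemmas

/-! ### Collapse of the four blocks when `F ^ 2 = 0`. -/

namespace Star

variable {ι : Type*} [Fintype ι] [DecidableEq ι] {E F : Matrix ι ι ℂ}

theorem coeff_eq_zero (h : drazin F = 0) (i : ℕ) : coeff E F i = 0 := by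
  induction i with
  | zero => simp [coeff, h]
  | succ i ih => simp [coeff, h, ih]

theorem tsum_mul_pow_eq (hF : F ^ 2 = 0) (f : ℕ → Matrix ι ι ℂ) :
    ∑' i : ℕ, f i * F ^ i = f 0 + f 1 * F := by
  rw [tsum_eq_sum (s := Finset.range 2), Finset.sum_range_succ, Finset.sum_range_one]
  · simp
  · intro i hi
    rw [pow_eq_zero_of_le (not_lt.mp (Finset.mem_range.not.mp hi)) hF, mul_zero]

/-- With `F^D = 0` and `F^π = I`, only the series without a factor `F^D` or `A_i` survives, and it
stops after two terms. -/
theorem Gam_eq (hF : F ^ 2 = 0) : Gam E F = drazin E + drazin E ^ 3 * F := by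
  have h := drazin_eq_zero_of_sq_eq_zero hF
  simp [Gam, coeffC, coeffA, coeff_eq_zero h, eigenproj, h,
    tsum_mul_pow_eq hF fun i => drazin E ^ (2 * i + 1)]

theorem Del_eq (hF : F ^ 2 = 0) : Del E F = drazin E ^ 2 + drazin E ^ 4 * F := by
  have h := drazin_eq_zero_of_sq_eq_zero hF
  simp [Del, coeffD, coeffB, coeff_eq_zero h, eigenproj, h,
    tsum_mul_pow_eq hF fun i => drazin E ^ (2 * i + 2)]

theorem Lam_eq_zero (hF : F ^ 2 = 0) : Lam E F = 0 := by
  have h := drazin_eq_zero_of_sq_eq_zero hF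
  simp [Lam, coeffA, coeff_eq_zero h, h]

theorem Xi_eq_zero (hF : F ^ 2 = 0) : Xi E F = 0 := by
  have h := drazin_eq_zero_of_sq_eq_zero hF
  simp [Xi, coeffB, coeff_eq_zero h, h]

end Star

/-! ### The Drazin inverse of `P + Q`. -/

/-- If `Q ^ 2 = 0`, then `P Q P (P Q)^π = 0` forces `(P Q) ^ 2 = 0`. -/
theorem sq_mul_eq_zero_of_mul_eigenproj {ι : Type*} [Fintype ι] [DecidableEq ι]
    {P Q : Matrix ι ι ℂ} (hQ : Q ^ 2 = 0) (hPQ : P * Q * P * eigenproj (P * Q) = 0) :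
    (P * Q) ^ 2 = 0 := by
  have hD : drazin (P * Q) * Q = 0 := by
    rw [← (isDrazinInverse_drazin (P * Q)).sq_mul, mul_assoc, mul_assoc P, ← sq, hQ, mul_zero,
      mul_zero]
  have e : eigenproj (P * Q) * Q = Q := by
    rw [eigenproj, sub_mul, mul_assoc _ _ Q, hD]
    simp
  calc (P * Q) ^ 2 = P * Q * P * (eigenproj (P * Q) * Q) := by
        rw [e, sq]; simp only [mul_assoc]
    _ = 0 := by rw [← mul_assoc, hPQ, zero_mul]

theorem corollary2p4 (n : ℕ) (P Q : Matrix (Fin n) (Fin n) ℂ)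
    (hQ : Q ^ 2 = 0) (hPQ : P * Q * P * eigenproj (P * Q) = 0)
    (K L : Matrix (Fin n ⊕ Fin n) (Fin n ⊕ Fin n) ℂ)
    (hK : K = Matrix.fromBlocks P (P * Q) 1 0)
    (hL : L = Matrix.fromBlocks 0 0 0 Q) :
    drazin (P + Q)
        = (Matrix.fromCols 1 Q : Matrix (Fin n) (Fin n ⊕ Fin n) ℂ)
            * (drazin K + L * drazin K ^ 2) ^ 2
            * (Matrix.fromRows P 1 : Matrix (Fin n ⊕ Fin n) (Fin n) ℂ) ∧
      drazin K
        = Matrix.fromBlocks P 1 1 0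
            * Matrix.fromBlocks (Star.Gam P (P * Q)) (Star.Del P (P * Q))
                (Star.Lam P (P * Q)) (Star.Xi P (P * Q)) ^ 2
            * Matrix.fromBlocks 1 0 0 (P * Q) ∧
      drazin (Matrix.fromBlocks P 1 (P * Q) 0)
        = Matrix.fromBlocks (Star.Gam P (P * Q)) (Star.Del P (P * Q))
            (Star.Lam P (P * Q)) (Star.Xi P (P * Q)) := by
  have hF : (P * Q) ^ 2 = 0 := sq_mul_eq_zero_of_mul_eigenproj hQ hPQ
  have hFE : P * Q * P = 0 := by
    simpa [eigenproj, drazin_eq_zero_of_sq_eq_zero hF] using hPQ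
  have hM : IsDrazinInverse (Matrix.fromBlocks P 1 (P * Q) 0)
      (Matrix.fromBlocks (Star.Gam P (P * Q)) (Star.Del P (P * Q))
        (Star.Lam P (P * Q)) (Star.Xi P (P * Q))) := by
    rw [Star.Gam_eq hF, Star.Del_eq hF, Star.Lam_eq_zero hF, Star.Xi_eq_zero hF]
    exact (isDrazinInverse_drazin P).fromBlocks_of_mul_eq_zero hFE (by rw [← sq, hF])
  refine ⟨?_, ?_, hM.drazin_eq⟩
  -- The only block of `K L` that is not trivially zero is `P Q²`.
  · have hKL : K * L = 0 := by
      simp [hK, hL, Matrix.fromBlocks_multiply, mul_assoc, ← sq, hQ]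
    have hLL : L ^ 2 = 0 := by
      rw [hL, sq, Matrix.fromBlocks_multiply]
      simp [← sq, hQ]
    have hBA : (Matrix.fromRows P 1 : Matrix (Fin n ⊕ Fin n) (Fin n) ℂ)
        * (Matrix.fromCols 1 Q : Matrix (Fin n) (Fin n ⊕ Fin n) ℂ) = K + L := by
      rw [Matrix.fromRows_mul_fromCols, hK, hL, Matrix.fromBlocks_add]
      simp
    have hAB : (Matrix.fromCols 1 Q : Matrix (Fin n) (Fin n ⊕ Fin n) ℂ)
        * (Matrix.fromRows P 1 : Matrix (Fin n ⊕ Fin n) (Fin n) ℂ) = P + Q := by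
      rw [Matrix.fromCols_mul_fromRows]
      simp
    have h := (isDrazinInverse_drazin K).add_of_mul_eq_zero hKL hLL
    rw [← hBA] at h
    have h' := h.cline
    rw [hAB] at h'
    exact h'.drazin_eq
  -- The diagonal factor `diag(I, PQ)` on the left gives the matrix treated in `hM`; on the right it
  -- gives `K`.
  · have hBA : (Matrix.fromBlocks 1 0 0 (P * Q) : Matrix (Fin n ⊕ Fin n) (Fin n ⊕ Fin n) ℂ)
        * Matrix.fromBlocks P 1 1 0 = Matrix.fromBlocks P 1 (P * Q) 0 := by
      simp [Matrix.fromBlocks_multiply]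
    have hAB : (Matrix.fromBlocks P 1 1 0 : Matrix (Fin n ⊕ Fin n) (Fin n ⊕ Fin n) ℂ)
        * Matrix.fromBlocks 1 0 0 (P * Q) = K := by
      simp [hK, Matrix.fromBlocks_multiply]
    rw [← hBA] at hM
    have h := hM.cline
    rw [hAB] at h
    exact h.drazin_eq
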